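/- Let $(a_k)_{k\in\mathbb N}$, $\mathbb N=\{1,2,\ldots\}$, be a sequence of positive integers with $a_{k+1}/a_k\to\infty$ as $k\to\infty$ (the large gap condition), let $U$ be a random variable with the uniform distribution on $[0,1]$, and put $S_n=\sum_{k=1}^n\cos(2\pi a_kU)$. Let $$\widetilde\Lambda(\theta)=\log\int_{-1}^1\frac{e^{\theta x}}{\pi\sqrt{1-x^2}}\,dx\quad(\theta\in\mathbb R),\qquad \widetilde I(x)=\sup_{\theta\in\mathbb R}\bigl[\theta x-\widetilde\Lambda(\theta)\bigr]\quad(x\in\mathbb R),$$ that is, $\widetilde I$ is the Legendre–Fenchel transform of the logarithmic moment generating function of the arcsine law, which has density $1/(\pi\sqrt{1-x^2})$ on $(-1,1)$. Then $(S_n/n)_{n\in\mathbb N}$ satisfies a large deviation principle with speed $n$ and rate function $\widetilde I$: the function $\widetilde I$ takes values in $[0,\infty]$ and is lower semicontinuous, and for every Borel set $A\subset\mathbb R$, with interior $A^\circ$ and closure $\bar A$, $$-\inf_{x\in A^\circ}\widetilde I(x)\le\liminf_{n\to\infty}\frac1n\log\mathbb P\Bigl(\frac{S_n}{n}\in A\Bigr)\le\limsup_{n\to\infty}\frac1n\log\mathbb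 P\Bigl(\frac{S_n}{n}\in A\Bigr)\le-\inf_{x\in\bar A}\widetilde I(x),$$ where $\log 0=-\infty$ and $\inf\emptyset=+\infty$. This is the same large deviation principle as in the independent case: if $\widetilde X_1,\widetilde X_2,\ldots$ are independent random variables with the arcsine law and $\widetilde S_n=\sum_{k=1}^n\widetilde X_k$, then $(\widetilde S_n/n)_{n\in\mathbb N}$ also satisfies a large deviation principle with speed $n$ and rate function $\widetilde I$. -/

import Mathlib

open MeasureTheory ProbabilityTheory Filter Topology

noncomputable section

namespace LacunaryLDP

/-- The random variables `X n` on `(Ω, P)`, with values in the topological space `E`, satisfy a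
large deviation principle with speed `s n` (nondecreasing to infinity) and rate function
`I : E → [0, ∞]`. Probabilities are in `[0, ∞]`, so `ENNReal.log` is the extended logarithm, with
`log 0 = -∞`; infima over the empty set are `+∞`. -/
structure SatisfiesLDP {Ω E : Type*} [MeasurableSpace Ω] [TopologicalSpace E] [MeasurableSpace E]
    [BorelSpace E] (P : Measure Ω) (X : ℕ → Ω → E) (s : ℕ → ℝ) (I : E → EReal) : Prop where
  speed_mono : Monotone s
  speed_tendsto : Tendsto s atTop atTop
  rate_nonneg : ∀ x, 0 ≤ I x
  rate_lsc : LowerSemicontinuous I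
  lower_bound : ∀ A : Set E, MeasurableSet A →
    -(⨅ x ∈ interior A, I x) ≤
      liminf (fun n => ENNReal.log (P {ω | X n ω ∈ A}) / (s n : EReal)) atTop
  upper_bound : ∀ A : Set E, MeasurableSet A →
    limsup (fun n => ENNReal.log (P {ω | X n ω ∈ A}) / (s n : EReal)) atTop ≤
      -(⨅ x ∈ closure A, I x)

/-- The arcsine law on `(-1, 1)`, with Lebesgue density `1 / (π √(1 - x²))`. -/
def arcsineLaw : Measure ℝ :=
  (volume.restrict (Set.Ioo (-1 : ℝ) 1)).withDensity
    (fun x => ENNReal.ofReal (1 / (Real.pi * √(1 - x ^ 2))))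

/-- The logarithmic moment generating function of the arcsine law,
`θ ↦ log ∫ exp (θ x) d(arcsineLaw)(x)`. -/
def arcsineLogMGF (θ : ℝ) : ℝ := cgf (fun x : ℝ => x) arcsineLaw θ

/-- The Legendre–Fenchel transform of a function on the real line, with values in `[-∞, ∞]`. -/
def legendreFenchel (Λ : ℝ → ℝ) (x : ℝ) : EReal := ⨆ θ : ℝ, ((θ * x - Λ θ : ℝ) : EReal)

/-- The rate function of sums of independent arcsine random variables. -/
def arcsineRate : ℝ → EReal := legendreFenchel arcsineLogMGF

/-- The lacunary sum `S_n = ∑_{k=1}^n cos (2 π a_k U)`. -/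
def lacunarySum {Ω : Type*} (a : ℕ → ℕ) (U : Ω → ℝ) (n : ℕ) (ω : Ω) : ℝ :=
  ∑ k ∈ Finset.Icc 1 n, Real.cos (2 * Real.pi * (a k : ℝ) * U ω)

end LacunaryLDP

end

/-!
The large deviation principle follows, in both cases, from the Gärtner–Ellis theorem once the
normalised logarithmic moment generating functions `cgf (S n) / n` are known to converge pointwise
to `arcsineLogMGF` (`satisfiesLDP_arcsineRate`). For independent variables they are equal to it for
`n ≥ 1`.

For lacunary sums put `M n = ∫₀¹ exp (θ S_n(u)) du`. The interval `[0, 1]` consists of `a (n + 1)`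
full periods of `cos (2 π a_{n+1} u)`. On each of them `exp (θ S_n)` varies at most by the factor
`exp (2 π |θ| (a_1 + ⋯ + a_n) / a_{n+1})`, and the integral of `exp (θ cos (2 π a_{n+1} u))` over it
is `exp (arcsineLogMGF θ) / a_{n+1}`, since `cos (2 π U)` has the arcsine law. Hence
`log M (n + 1) - log M n` differs from `arcsineLogMGF θ` by at most
`2 π |θ| (a_1 + ⋯ + a_n) / a_{n+1}`, which tends to zero by the large gap condition, and Cesàro's
theorem gives the limit of `log M n / n` (`tendsto_log_lacunaryMGF_div`).

In the Gärtner–Ellis theorem the averages lie in the compact set `[-1, 1]`, so the upper bound is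
Chernoff's bound with a finite cover (`expGrowthSup_le_of_isClosed`). The lower bound at
`x = Λ' θ` comes from exponential tilting (`le_expGrowthInf_of_hasDerivAt`). Every `x` in `(-1, 1)`
is of that form (`exists_hasDerivAt_arcsineLogMGF`), the rate is infinite for `|x| > 1`, and the
points `±1` are approached along the rays from `0`, where the rate is monotone
(`legendreFenchel_mul_le`).
-/

namespace LacunaryLDP

/-! ### The Gärtner–Ellis bounds -/

section GartnerEllis

variable {Ω : Type*} [MeasurableSpace Ω] {P : Measure Ω} [IsProbabilityMeasure P]
  {S : ℕ → Ω → ℝ} {Λ : ℝ → ℝ}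

lemma tendsto_exp_of_tendsto_div_neg {b : ℕ → ℝ} {l : ℝ} (hl : l < 0)
    (hb : Tendsto (fun n : ℕ => b n / n) atTop (𝓝 l)) :
    Tendsto (fun n => Real.exp (b n)) atTop (𝓝 0) := by
  refine Real.tendsto_exp_atBot.comp ?_
  refine (tendsto_natCast_atTop_atTop.atTop_mul_neg hl hb).congr' ?_
  filter_upwards [eventually_gt_atTop 0] with n hn
  have : (n : ℝ) ≠ 0 := by positivity
  field_simp

/-- Chernoff's bound on the exponential scale, for a half-line in the direction of `θ`. -/
lemma expGrowthSup_halfLine_le (hint : ∀ n θ, Integrable (fun ω => Real.exp (θ * S n ω)) P)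
    {θ : ℝ} (hΛ : Tendsto (fun n : ℕ => cgf (S n) P θ / n) atTop (𝓝 (Λ θ))) (c : ℝ) :
    ExpGrowth.expGrowthSup (fun n => P {ω | c ≤ θ * (S n ω / n)}) ≤ ((Λ θ - c : ℝ) : EReal) := by
  refine EReal.le_of_forall_lt_iff_le.1 fun z hz => ?_
  have hz' : Λ θ < z + c := by
    have := EReal.coe_lt_coe_iff.1 hz
    linarith
  refine _root_.Eventually.expGrowthSup_le ?_
  filter_upwards [hΛ.eventually_lt_const hz', eventually_gt_atTop 0] with n hn hn0
  have hn0' : (0 : ℝ) < n := by exact_mod_cast hn0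
  have hX : Integrable (fun ω => Real.exp (1 * (θ * S n ω))) P := by simpa using hint n θ
  have h1 := measure_ge_le_exp_cgf (X := fun ω => θ * S n ω) (n * c) zero_le_one hX
  have hc : cgf (fun ω => θ * S n ω) P 1 = cgf (S n) P θ := by simp [cgf, mgf]
  have hset : {ω | c ≤ θ * (S n ω / n)} = {ω | n * c ≤ θ * S n ω} := by
    ext ω
    simp only [Set.mem_ofPred_eq]
    rw [← mul_div_assoc, le_div_iff₀ hn0', mul_comm c]
  rw [hset, ← ENNReal.ofReal_toReal (measure_ne_top P _)]
  have : ((z : EReal) * (n : EReal)) = ((z * n : ℝ) : EReal) := by push_cast; rfl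
  rw [this, EReal.exp_coe]
  refine ENNReal.ofReal_le_ofReal (h1.trans (Real.exp_le_exp.2 ?_))
  rw [hc]
  rw [div_lt_iff₀ hn0'] at hn
  nlinarith

/-- The upper bound of the Gärtner–Ellis theorem, for closed sets and for averages with values in
`[-1, 1]`: finitely many of the half-lines of Chernoff's bound cover the closed set. -/
lemma expGrowthSup_le_of_isClosed
    (hint : ∀ n θ, Integrable (fun ω => Real.exp (θ * S n ω)) P)
    (hbd : ∀ n, ∀ᵐ ω ∂P, |S n ω| ≤ n)
    (hΛ : ∀ θ, Tendsto (fun n : ℕ => cgf (S n) P θ / n) atTop (𝓝 (Λ θ)))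
    {F : Set ℝ} (hF : IsClosed F) :
    ExpGrowth.expGrowthSup (fun n => P {ω | S n ω / n ∈ F}) ≤ -(⨅ x ∈ F, legendreFenchel Λ x) := by
  by_contra! hlt
  obtain ⟨c, hc1, hc2⟩ := EReal.lt_iff_exists_real_btwn.1 hlt
  have hc : ∀ x ∈ F, ∃ θ : ℝ, -c < θ * x - Λ θ := by
    intro x hx
    have h : ((-c : ℝ) : EReal) < legendreFenchel Λ x := by
      refine lt_of_lt_of_le ?_ (iInf₂_le (f := fun y (_ : y ∈ F) => legendreFenchel Λ y) x hx)
      rw [EReal.coe_neg]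
      exact EReal.neg_lt_comm.1 hc1
    obtain ⟨θ, hθ⟩ := lt_iSup_iff.1 h
    exact ⟨θ, EReal.coe_lt_coe_iff.1 hθ⟩
  choose! θ hθ using hc
  have hK : IsCompact (F ∩ Set.Icc (-1 : ℝ) 1) := isCompact_Icc.inter_left hF
  obtain ⟨t, htF, ht⟩ := hK.elim_nhds_subcover
    (fun x => {y | Λ (θ x) - c < θ x * y}) (fun x hx => by
      refine (isOpen_lt (by fun_prop) (by fun_prop)).mem_nhds ?_
      have := hθ x hx.1
      simp only [Set.mem_ofPred_eq]
      linarith)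
  refine absurd hc2 (not_lt.2 ?_)
  calc ExpGrowth.expGrowthSup (fun n => P {ω | S n ω / n ∈ F})
      ≤ ExpGrowth.expGrowthSup
          (∑ x ∈ t, fun n => P {ω | Λ (θ x) - c ≤ θ x * (S n ω / n)}) := by
        refine ExpGrowth.expGrowthSup_monotone fun n => ?_
        rw [Finset.sum_apply]
        refine le_trans ?_ (measure_biUnion_finset_le t _)
        refine measure_mono_ae ?_
        filter_upwards [hbd n] with ω hω hωF
        have hmem : S n ω / n ∈ F ∩ Set.Icc (-1 : ℝ) 1 :=
          ⟨hωF, abs_le.1 (by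
            rw [abs_div, Nat.abs_cast]
            exact div_le_one_of_le₀ hω (Nat.cast_nonneg n))⟩
        obtain ⟨x, hx, hxy⟩ := Set.mem_iUnion₂.1 (ht hmem)
        have hxy' : Λ (θ x) - c < θ x * (S n ω / n) := hxy
        exact Set.mem_iUnion₂.2 ⟨x, hx, Set.mem_ofPred_eq.symm ▸ hxy'.le⟩
    _ ≤ c := by
        rw [ExpGrowth.expGrowthSup_sum]
        refine iSup₂_le fun x _ => ?_
        refine (expGrowthSup_halfLine_le hint (hΛ (θ x)) _).trans (le_of_eq ?_)
        simp

/-- The lower bound of the Gärtner–Ellis theorem at a point `x = Λ' θ`. Under the exponentially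
tilted law, with density proportional to `exp (θ S_n)`, the averages concentrate at `x`, because
Chernoff's bound with the slopes `θ ± η` makes the complement of a neighbourhood of `x`
negligible. -/
lemma le_expGrowthInf_of_hasDerivAt
    (hmeas : ∀ n, AEMeasurable (S n) P)
    (hint : ∀ n θ, Integrable (fun ω => Real.exp (θ * S n ω)) P)
    (hΛ : ∀ θ, Tendsto (fun n : ℕ => cgf (S n) P θ / n) atTop (𝓝 (Λ θ)))
    {θ x : ℝ} (hd : HasDerivAt Λ x θ) {G : Set ℝ} (hG : G ∈ 𝓝 x) :
    ((Λ θ - θ * x : ℝ) : EReal) ≤ ExpGrowth.expGrowthInf (fun n => P {ω | S n ω / n ∈ G}) := by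
  refine EReal.ge_of_forall_gt_iff_ge.1 fun z hz => ?_
  have hz' : z < Λ θ - θ * x := EReal.coe_lt_coe_iff.1 hz
  obtain ⟨δ₀, hδ₀, hball⟩ := Metric.mem_nhds_iff.1 hG
  -- On the ball of radius `δ` the weight `exp (θ S_n)` is constant up to `exp (n |θ| δ)`.
  obtain ⟨δ, hδ, hδ₀', hδz⟩ : ∃ δ > 0, δ ≤ δ₀ ∧ |θ| * δ < Λ θ - θ * x - z := by
    refine ⟨min δ₀ ((Λ θ - θ * x - z) / (|θ| + 1)), ?_, min_le_left _ _, ?_⟩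
    · exact lt_min hδ₀ (div_pos (by linarith) (by positivity))
    · have h1 : (0 : ℝ) < |θ| + 1 := by positivity
      have h2 : 0 < (Λ θ - θ * x - z) / (|θ| + 1) := div_pos (by linarith) h1
      calc |θ| * min δ₀ ((Λ θ - θ * x - z) / (|θ| + 1))
          ≤ |θ| * ((Λ θ - θ * x - z) / (|θ| + 1)) := by gcongr; exact min_le_right _ _
        _ < (|θ| + 1) * ((Λ θ - θ * x - z) / (|θ| + 1)) := by gcongr; linarith
        _ = Λ θ - θ * x - z := by field_simp
  -- The two inequalities say that under the tilted law the Chernoff exponents of the events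
  -- `S_n / n ≥ x + δ` and `S_n / n ≤ x - δ`, with the slopes `±η`, are negative.
  obtain ⟨η, hη, hη1, hη2⟩ : ∃ η > 0, Λ (θ + η) - Λ θ - η * (x + δ) < 0 ∧
      Λ (θ - η) - Λ θ + η * (x - δ) < 0 := by
    have h := (hasDerivAt_iff_isLittleO_nhds_zero.1 hd).bound (half_pos hδ)
    obtain ⟨r, hr, hr'⟩ := Metric.eventually_nhds_iff.1 h
    have e1 := @hr' (r / 2) (by simp [abs_of_pos hr]; linarith)
    have e2 := @hr' (-(r / 2)) (by simp [abs_of_pos hr]; linarith)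
    simp only [Real.norm_eq_abs, smul_eq_mul, abs_neg, abs_of_pos (half_pos hr)] at e1 e2
    refine ⟨r / 2, half_pos hr, ?_, ?_⟩
    · have := (abs_le.1 e1).2
      nlinarith
    · have := (abs_le.1 e2).2
      rw [← sub_eq_add_neg] at this
      nlinarith
  have t1 : Tendsto (fun n : ℕ => Real.exp
      (cgf (S n) P (θ + η) - cgf (S n) P θ - n * (η * (x + δ)))) atTop (𝓝 0) := by
    refine tendsto_exp_of_tendsto_div_neg hη1 ?_
    refine (((hΛ (θ + η)).sub (hΛ θ)).sub_const (η * (x + δ))).congr' ?_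
    filter_upwards [eventually_gt_atTop 0] with n hn
    have : (n : ℝ) ≠ 0 := by positivity
    field_simp
  have t2 : Tendsto (fun n : ℕ => Real.exp
      (cgf (S n) P (θ - η) - cgf (S n) P θ + n * (η * (x - δ)))) atTop (𝓝 0) := by
    refine tendsto_exp_of_tendsto_div_neg hη2 ?_
    refine (((hΛ (θ - η)).sub (hΛ θ)).add_const (η * (x - δ))).congr' ?_
    filter_upwards [eventually_gt_atTop 0] with n hn
    have : (n : ℝ) ≠ 0 := by positivity
    field_simp
  have t3 : Tendsto (fun n : ℕ => cgf (S n) P θ / n - Real.log 2 / n) atTop (𝓝 (Λ θ)) := by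
    simpa using (hΛ θ).sub (tendsto_const_nhds.div_atTop tendsto_natCast_atTop_atTop)
  refine _root_.Eventually.le_expGrowthInf ?_
  filter_upwards [t1.eventually_le_const (show (0 : ℝ) < 1 / 4 by norm_num),
    t2.eventually_le_const (show (0 : ℝ) < 1 / 4 by norm_num),
    t3.eventually_const_le (show z + θ * x + |θ| * δ < Λ θ by linarith),
    eventually_gt_atTop 0] with n h1 h2 h3 hn0
  have hn0' : (0 : ℝ) < n := by exact_mod_cast hn0
  set B : Set Ω := {ω | S n ω / n ∈ Metric.ball x δ} with hB
  have hBm : NullMeasurableSet B P :=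
    ((hmeas n).div_const (n : ℝ)).nullMeasurable Metric.isOpen_ball.measurableSet
  set K := Real.exp (n * (θ * x + |θ| * δ)) with hK
  have hpt : ∀ ω, Real.exp (θ * S n ω) ≤ B.indicator (fun _ => K) ω +
      Real.exp (-(n * (η * (x + δ)))) * Real.exp ((θ + η) * S n ω) +
      Real.exp (n * (η * (x - δ))) * Real.exp ((θ - η) * S n ω) := by
    intro ω
    by_cases hω : ω ∈ B
    · rw [Set.indicator_of_mem hω]
      have : Real.exp (θ * S n ω) ≤ K := by
        refine Real.exp_le_exp.2 ?_
        have hd : |S n ω / n - x| < δ := by simpa [hB, Real.dist_eq] using hω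
        have h5 : θ * (S n ω / n - x) ≤ |θ| * δ :=
          (le_abs_self _).trans (by rw [abs_mul]; gcongr)
        have h6 : θ * S n ω = n * (θ * x + θ * (S n ω / n - x)) := by field_simp; ring
        rw [h6]
        gcongr
      exact le_add_of_le_of_nonneg (le_add_of_le_of_nonneg this (by positivity)) (by positivity)
    · rw [Set.indicator_of_notMem hω, zero_add, ← Real.exp_add, ← Real.exp_add]
      have hd : δ ≤ |S n ω / n - x| := by simpa [hB, Real.dist_eq] using hω
      have h6 : S n ω = n * (S n ω / n) := by field_simp
      rcases le_abs.1 hd with hd | hd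
      · refine le_add_of_le_of_nonneg (Real.exp_le_exp.2 ?_) (Real.exp_pos _).le
        have : n * (x + δ) ≤ S n ω := by rw [h6]; gcongr; linarith
        nlinarith
      · refine le_add_of_nonneg_of_le (Real.exp_pos _).le (Real.exp_le_exp.2 ?_)
        have : S n ω ≤ n * (x - δ) := by rw [h6]; gcongr; linarith
        nlinarith
  have i1 : Integrable (B.indicator (fun _ => K)) P := (integrable_const K).indicator₀ hBm
  have i2 := (hint n (θ + η)).const_mul (Real.exp (-(n * (η * (x + δ)))))
  have i3 := (hint n (θ - η)).const_mul (Real.exp (n * (η * (x - δ))))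
  have hI := integral_mono (hint n θ) ((i1.add i2).add i3) hpt
  rw [integral_add' (i1.add i2) i3, integral_add' i1 i2, integral_const_mul, integral_const_mul,
    integral_indicator₀ hBm, setIntegral_const, smul_eq_mul] at hI
  have hm : ∀ s, ∫ ω, Real.exp (s * S n ω) ∂P = Real.exp (cgf (S n) P s) :=
    fun s => (exp_cgf (hint n s)).symm
  rw [hm, hm, hm, ← Real.exp_add, ← Real.exp_add] at hI
  have e1 : Real.exp (-(n * (η * (x + δ))) + cgf (S n) P (θ + η)) ≤
      1 / 4 * Real.exp (cgf (S n) P θ) := by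
    rw [← div_le_iff₀ (Real.exp_pos _), ← Real.exp_sub]
    refine le_trans (le_of_eq ?_) h1
    ring_nf
  have e2 : Real.exp (n * (η * (x - δ)) + cgf (S n) P (θ - η)) ≤
      1 / 4 * Real.exp (cgf (S n) P θ) := by
    rw [← div_le_iff₀ (Real.exp_pos _), ← Real.exp_sub]
    refine le_trans (le_of_eq ?_) h2
    ring_nf
  have hfin : Real.exp (z * n) ≤ P.real B := by
    rw [← mul_le_mul_iff_left₀ (Real.exp_pos (n * (θ * x + |θ| * δ)))]
    have h7 : z * n + n * (θ * x + |θ| * δ) ≤ cgf (S n) P θ - Real.log 2 := by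
      rw [← sub_div, le_div_iff₀ hn0'] at h3
      linarith
    have h8 := Real.exp_le_exp.2 h7
    rw [Real.exp_sub, Real.exp_log two_pos] at h8
    rw [← Real.exp_add]
    linarith
  have hzn : ((z : EReal) * (n : EReal)) = ((z * n : ℝ) : EReal) := by push_cast; rfl
  rw [hzn, EReal.exp_coe]
  calc ENNReal.ofReal (Real.exp (z * n)) ≤ ENNReal.ofReal (P.real B) :=
        ENNReal.ofReal_le_ofReal hfin
    _ = P B := ENNReal.ofReal_toReal (measure_ne_top P _)
    _ ≤ P {ω | S n ω / n ∈ G} :=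
        measure_mono fun ω hω => hball (Metric.ball_subset_ball hδ₀' hω)

end GartnerEllis

/-! ### The arcsine law -/

lemma image_cos_Ioo : Real.cos '' Set.Ioo 0 Real.pi = Set.Ioo (-1) 1 :=
  Real.cosPartialHomeomorph.image_source_eq_target

/-- Substituting `x = cos t` in the arcsine density leaves the uniform law on `(0, π)`. -/
lemma arcsineLaw_eq_map_cos : arcsineLaw = Measure.map Real.cos
    (ENNReal.ofReal (Real.pi⁻¹) • volume.restrict (Set.Ioo 0 Real.pi)) := by
  ext s hs
  rw [Measure.map_apply Real.measurable_cos hs, Measure.smul_apply, smul_eq_mul, arcsineLaw,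
    withDensity_apply _ hs, ← lintegral_indicator hs, ← image_cos_Ioo,
    lintegral_image_eq_lintegral_abs_deriv_mul measurableSet_Ioo
      (fun x _ => (Real.hasDerivAt_cos x).hasDerivWithinAt)
      (Real.injOn_cos.mono Set.Ioo_subset_Icc_self),
    ← lintegral_indicator_one (Real.measurable_cos hs),
    ← lintegral_const_mul _ (measurable_one.indicator (Real.measurable_cos hs))]
  refine setLIntegral_congr_fun measurableSet_Ioo fun t ht => ?_
  have hsin : 0 < Real.sin t := Real.sin_pos_of_pos_of_lt_pi ht.1 ht.2
  by_cases hc : Real.cos t ∈ s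
  · have hc' : t ∈ Real.cos ⁻¹' s := hc
    rw [Set.indicator_of_mem hc, Set.indicator_of_mem hc', ← ENNReal.ofReal_mul (abs_nonneg _),
      Pi.one_apply, mul_one, ← Real.sin_sq, Real.sqrt_sq hsin.le, abs_neg, abs_of_pos hsin]
    congr 1
    field_simp
  · have hc' : t ∉ Real.cos ⁻¹' s := hc
    rw [Set.indicator_of_notMem hc, Set.indicator_of_notMem hc', mul_zero, mul_zero]

instance : IsProbabilityMeasure arcsineLaw := by
  constructor
  rw [arcsineLaw_eq_map_cos, Measure.map_apply Real.measurable_cos MeasurableSet.univ]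
  simp only [Set.preimage_univ, Measure.smul_apply, Measure.restrict_apply_univ, Real.volume_Ioo,
    sub_zero, smul_eq_mul]
  rw [← ENNReal.ofReal_mul (by positivity), inv_mul_cancel₀ Real.pi_ne_zero, ENNReal.ofReal_one]

lemma ae_arcsineLaw_mem_Icc : ∀ᵐ x ∂arcsineLaw, x ∈ Set.Icc (-1 : ℝ) 1 := by
  refine arcsineLaw_eq_map_cos ▸ (ae_map_iff Real.measurable_cos.aemeasurable measurableSet_Icc).2 ?_
  exact ae_of_all _ fun t => Real.cos_mem_Icc t

lemma arcsineLaw_pos_of_isOpen {s : Set ℝ} (hs : IsOpen s)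
    (hne : (s ∩ Set.Ioo (-1) 1).Nonempty) : 0 < arcsineLaw s := by
  rw [arcsineLaw_eq_map_cos, Measure.map_apply Real.measurable_cos hs.measurableSet,
    Measure.smul_apply, Measure.restrict_apply (Real.measurable_cos hs.measurableSet), smul_eq_mul]
  refine ENNReal.mul_pos (by simpa using Real.pi_pos) ?_
  obtain ⟨x, hxs, hx⟩ := hne
  refine (IsOpen.measure_pos _ ((hs.preimage Real.continuous_cos).inter isOpen_Ioo) ?_).ne'
  rw [← image_cos_Ioo] at hx
  obtain ⟨t, ht, rfl⟩ := hx
  exact ⟨t, hxs, ht⟩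

lemma integrable_exp_mul_arcsineLaw (θ : ℝ) :
    Integrable (fun x : ℝ => Real.exp (θ * x)) arcsineLaw :=
  integrable_exp_mul_of_mem_Icc aemeasurable_id ae_arcsineLaw_mem_Icc

/-- The arcsine law is the law of `cos (2 π U)` for a uniform variable `U` on `[0, 1]`; here at the
level of moment generating functions. -/
lemma exp_arcsineLogMGF (θ : ℝ) :
    Real.exp (arcsineLogMGF θ) = ∫ u in (0 : ℝ)..1, Real.exp (θ * Real.cos (2 * Real.pi * u)) := by
  set g : ℝ → ℝ := fun t => Real.exp (θ * Real.cos t) with hg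
  have hgc : Continuous g := by fun_prop
  have h1 : Real.exp (arcsineLogMGF θ) = Real.pi⁻¹ * ∫ t in (0 : ℝ)..Real.pi, g t := by
    rw [arcsineLogMGF, exp_cgf (integrable_exp_mul_arcsineLaw θ), mgf, arcsineLaw_eq_map_cos,
      integral_map Real.measurable_cos.aemeasurable (by fun_prop), integral_smul_measure,
      ENNReal.toReal_ofReal (by positivity), smul_eq_mul,
      intervalIntegral.integral_of_le Real.pi_pos.le, integral_Ioc_eq_integral_Ioo]
  have h2 : ∫ t in Real.pi..(2 * Real.pi), g t = ∫ t in (0 : ℝ)..Real.pi, g t := by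
    have h := intervalIntegral.integral_comp_sub_left (a := 0) (b := Real.pi) g (2 * Real.pi)
    rw [sub_zero, two_mul, add_sub_cancel_right, ← two_mul] at h
    rw [← h]
    simp [hg, Real.cos_two_pi_sub]
  have h3 : ∫ u in (0 : ℝ)..1, g (2 * Real.pi * u) =
      (2 * Real.pi)⁻¹ * ∫ t in (0 : ℝ)..(2 * Real.pi), g t := by
    rw [intervalIntegral.integral_comp_mul_left g (by positivity)]
    simp
  rw [h1]
  change _ = ∫ u in (0 : ℝ)..1, g (2 * Real.pi * u)
  rw [h3, ← intervalIntegral.integral_add_adjacent_intervals (hgc.intervalIntegrable 0 Real.pi)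
    (hgc.intervalIntegrable Real.pi (2 * Real.pi)), h2]
  field_simp
  ring

lemma differentiable_arcsineLogMGF : Differentiable ℝ arcsineLogMGF := fun θ => by
  refine (analyticAt_cgf (X := fun x : ℝ => x) (μ := arcsineLaw) ?_).differentiableAt
  have : integrableExpSet (fun x : ℝ => x) arcsineLaw = Set.univ :=
    Set.eq_univ_of_forall integrable_exp_mul_arcsineLaw
  simp [this]

@[simp]
lemma arcsineLogMGF_zero : arcsineLogMGF 0 = 0 := cgf_zero

lemma arcsineLogMGF_le_abs (θ : ℝ) : arcsineLogMGF θ ≤ |θ| := by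
  rw [← Real.exp_le_exp, arcsineLogMGF, exp_cgf (integrable_exp_mul_arcsineLaw θ), mgf]
  calc ∫ x, Real.exp (θ * x) ∂arcsineLaw ≤ ∫ _, Real.exp |θ| ∂arcsineLaw := by
        refine integral_mono_ae (integrable_exp_mul_arcsineLaw θ) (integrable_const _) ?_
        filter_upwards [ae_arcsineLaw_mem_Icc] with x hx
        refine Real.exp_le_exp.2 ((le_abs_self _).trans ?_)
        rw [abs_mul]
        exact mul_le_of_le_one_right (abs_nonneg _) (abs_le.2 hx)
    _ = Real.exp |θ| := by simp

/-- For `|x| < 1` the function `θ ↦ arcsineLogMGF θ - θ x` is coercive, since the arcsine law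
charges every neighbourhood of `±1`; at its minimum the derivative of `arcsineLogMGF` is `x`. -/
lemma exists_hasDerivAt_arcsineLogMGF {x : ℝ} (hx : |x| < 1) :
    ∃ θ, HasDerivAt arcsineLogMGF x θ := by
  obtain ⟨r, hxr, hr⟩ := exists_between hx
  have hr0 : 0 ≤ r := (abs_nonneg x).trans hxr.le
  have hpos₁ : 0 < arcsineLaw.real {y | r ≤ y} := by
    refine ENNReal.toReal_pos (ne_of_gt ?_) (measure_ne_top _ _)
    refine lt_of_lt_of_le (arcsineLaw_pos_of_isOpen isOpen_Ioi (s := Set.Ioi r) ?_)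
      (measure_mono fun y (hy : r < y) => hy.le)
    obtain ⟨y, hy, hy'⟩ := exists_between hr
    exact ⟨y, hy, by linarith, hy'⟩
  have hpos₂ : 0 < arcsineLaw.real {y | y ≤ -r} := by
    refine ENNReal.toReal_pos (ne_of_gt ?_) (measure_ne_top _ _)
    refine lt_of_lt_of_le (arcsineLaw_pos_of_isOpen isOpen_Iio (s := Set.Iio (-r)) ?_)
      (measure_mono fun y (hy : y < -r) => hy.le)
    obtain ⟨y, hy, hy'⟩ := exists_between hr
    exact ⟨-y, neg_lt_neg hy, by linarith, by linarith⟩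
  set c := min (arcsineLaw.real {y | r ≤ y}) (arcsineLaw.real {y | y ≤ -r}) with hc
  have hc0 : 0 < c := lt_min hpos₁ hpos₂
  have hlow : ∀ θ, (r - |x|) * ‖θ‖ + Real.log c ≤ arcsineLogMGF θ - θ * x := by
    intro θ
    have hθx : θ * x ≤ |θ| * |x| := (le_abs_self _).trans (abs_mul _ _).le
    have key : Real.log c ≤ -(|θ| * r) + arcsineLogMGF θ := by
      rw [Real.log_le_iff_le_exp hc0]
      rcases le_total 0 θ with h | h
      · refine (min_le_left _ _).trans ((measure_ge_le_exp_cgf r h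
          (integrable_exp_mul_arcsineLaw θ)).trans (le_of_eq ?_))
        rw [abs_of_nonneg h, neg_mul]
        rfl
      · refine (min_le_right _ _).trans ((measure_le_le_exp_cgf (-r) h
          (integrable_exp_mul_arcsineLaw θ)).trans (le_of_eq ?_))
        rw [abs_of_nonpos h, mul_neg]
        rfl
    rw [Real.norm_eq_abs]
    linarith
  have htend : Tendsto (fun θ => arcsineLogMGF θ - θ * x) (cocompact ℝ) atTop :=
    tendsto_atTop_mono hlow (tendsto_atTop_add_const_right _ _
      (tendsto_norm_cocompact_atTop.const_mul_atTop (sub_pos.2 hxr)))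
  have hcont : Continuous (fun θ => arcsineLogMGF θ - θ * x) :=
    differentiable_arcsineLogMGF.continuous.sub (by fun_prop)
  obtain ⟨θ, hθ⟩ := hcont.exists_forall_le htend
  refine ⟨θ, ?_⟩
  have hd := (differentiable_arcsineLogMGF θ).hasDerivAt
  have hd' : HasDerivAt (fun θ => arcsineLogMGF θ - θ * x) (deriv arcsineLogMGF θ - x) θ := by
    simpa using! hd.fun_sub ((hasDerivAt_id θ).mul_const x)
  have h0 := IsLocalMin.hasDerivAt_eq_zero (Filter.Eventually.of_forall hθ) hd'
  rwa [sub_eq_zero.1 h0] at hd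

/-- Jensen's inequality, as the arcsine law is centred. -/
lemma arcsineLogMGF_nonneg (θ : ℝ) : 0 ≤ arcsineLogMGF θ := by
  have h : 1 ≤ Real.exp (arcsineLogMGF θ) := by
    rw [exp_arcsineLogMGF]
    have hc : ∫ u in (0 : ℝ)..1, (θ * Real.cos (2 * Real.pi * u) + 1) = 1 := by
      rw [intervalIntegral.integral_add (Continuous.intervalIntegrable (by fun_prop) 0 1)
        (by simp), intervalIntegral.integral_const_mul,
        intervalIntegral.integral_comp_mul_left Real.cos (by positivity), integral_cos]
      simp
    refine hc.symm.le.trans ?_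
    exact intervalIntegral.integral_mono_on (μ := volume) zero_le_one
      (Continuous.intervalIntegrable (by fun_prop) 0 1)
      (Continuous.intervalIntegrable (by fun_prop) 0 1) fun u _ => Real.add_one_le_exp _
  exact Real.one_le_exp_iff.1 h

/-! ### The rate function -/

lemma legendreFenchel_nonneg {Λ : ℝ → ℝ} (h : Λ 0 = 0) (x : ℝ) : 0 ≤ legendreFenchel Λ x :=
  le_iSup_of_le 0 (by simp [h])

lemma lowerSemicontinuous_legendreFenchel (Λ : ℝ → ℝ) :
    LowerSemicontinuous (legendreFenchel Λ) :=
  lowerSemicontinuous_iSup fun θ =>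
    (continuous_coe_real_ereal.comp
      (show Continuous fun x : ℝ => θ * x - Λ θ by fun_prop)).lowerSemicontinuous

/-- The Legendre–Fenchel transform of a nonnegative function vanishing at `0` is nondecreasing along
the rays from the origin. -/
lemma legendreFenchel_mul_le {Λ : ℝ → ℝ} (h0 : Λ 0 = 0) (hΛ : ∀ θ, 0 ≤ Λ θ) {t : ℝ} (ht : 0 ≤ t)
    (ht1 : t ≤ 1) (x : ℝ) : legendreFenchel Λ (t * x) ≤ legendreFenchel Λ x := by
  refine iSup_le fun θ => ?_
  rcases le_total 0 (θ * x) with h | h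
  · refine le_iSup_of_le θ (EReal.coe_le_coe_iff.2 ?_)
    nlinarith [mul_le_of_le_one_left h ht1]
  · refine le_trans (EReal.coe_le_coe_iff.2 ?_) (legendreFenchel_nonneg h0 x)
    nlinarith [mul_nonpos_of_nonneg_of_nonpos ht h, hΛ θ]

lemma arcsineRate_eq_top {x : ℝ} (hx : 1 < |x|) : arcsineRate x = ⊤ := by
  refine EReal.eq_top_iff_forall_lt _ |>.2 fun y => ?_
  have hx' : 0 < |x| - 1 := sub_pos.2 hx
  have key : ∃ θ : ℝ, y < θ * x - |θ| := by
    set s := (|y| + 1) / (|x| - 1) with hs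
    have hs0 : 0 < s := by positivity
    have hy : y < s * (|x| - 1) := by
      rw [hs, div_mul_cancel₀ _ hx'.ne']
      linarith [le_abs_self y]
    rcases le_total 0 x with h | h
    · refine ⟨s, ?_⟩
      rw [abs_of_nonneg h] at hy
      rw [abs_of_pos hs0]
      linarith
    · refine ⟨-s, ?_⟩
      rw [abs_of_nonpos h] at hy
      rw [abs_neg, abs_of_pos hs0]
      linarith
  obtain ⟨θ, hθ⟩ := key
  refine lt_of_lt_of_le (EReal.coe_lt_coe_iff.2 (lt_of_lt_of_le hθ ?_))
    (le_iSup (fun θ : ℝ => ((θ * x - arcsineLogMGF θ : ℝ) : EReal)) θ)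
  linarith [arcsineLogMGF_le_abs θ]

/-! ### The large deviation principle from the moment generating functions -/

/-- The Gärtner–Ellis theorem for averages with values in `[-1, 1]` whose limiting logarithmic
moment generating function is that of the arcsine law. -/
theorem satisfiesLDP_arcsineRate {Ω : Type*} [MeasurableSpace Ω] {P : Measure Ω}
    [IsProbabilityMeasure P] {S : ℕ → Ω → ℝ} (hmeas : ∀ n, AEMeasurable (S n) P)
    (hbd : ∀ n, ∀ᵐ ω ∂P, |S n ω| ≤ n)
    (hΛ : ∀ θ, Tendsto (fun n : ℕ => cgf (S n) P θ / n) atTop (𝓝 (arcsineLogMGF θ))) :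
    SatisfiesLDP P (fun n ω => S n ω / n) (fun n => n) arcsineRate := by
  have hint : ∀ n θ, Integrable (fun ω => Real.exp (θ * S n ω)) P := fun n θ =>
    integrable_exp_mul_of_mem_Icc (hmeas n) ((hbd n).mono fun _ => abs_le.1)
  refine ⟨Nat.mono_cast, tendsto_natCast_atTop_atTop, legendreFenchel_nonneg arcsineLogMGF_zero,
    lowerSemicontinuous_legendreFenchel _, fun A _ => ?_, fun A _ => ?_⟩
  · have hlow : ∀ x ∈ interior A, |x| < 1 →
        -arcsineRate x ≤ ExpGrowth.expGrowthInf (fun n => P {ω | S n ω / n ∈ A}) := by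
      intro x hxA hx
      obtain ⟨θ, hθ⟩ := exists_hasDerivAt_arcsineLogMGF hx
      refine le_trans ?_ (le_expGrowthInf_of_hasDerivAt hmeas hint hΛ hθ
        (mem_interior_iff_mem_nhds.1 hxA))
      rw [EReal.neg_le, ← EReal.coe_neg, neg_sub]
      exact le_iSup (fun θ : ℝ => ((θ * x - arcsineLogMGF θ : ℝ) : EReal)) θ
    change _ ≤ ExpGrowth.expGrowthInf (fun n => P {ω | S n ω / n ∈ A})
    rw [EReal.neg_le]
    refine le_iInf₂ fun x hxA => ?_
    rcases lt_or_ge 1 |x| with hx | hx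
    · rw [arcsineRate_eq_top hx]
      exact le_top
    -- A point `x = ±1` is replaced by `t x` with `t < 1` close to `1`.
    have hev : ∀ᶠ t in 𝓝 (1 : ℝ), t * x ∈ interior A :=
      (show Continuous fun t : ℝ => t * x by fun_prop).continuousAt.eventually_mem
        (by simpa using isOpen_interior.mem_nhds hxA)
    obtain ⟨t, ht, ht0, ht1⟩ := ((hev.filter_mono nhdsWithin_le_nhds).and
      (Ioo_mem_nhdsLT (zero_lt_one' ℝ))).exists
    refine (EReal.neg_le.1 (hlow _ ht ?_)).trans
      (legendreFenchel_mul_le arcsineLogMGF_zero arcsineLogMGF_nonneg ht0.le ht1.le x)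
    rw [abs_mul, abs_of_pos ht0]
    nlinarith
  · refine le_trans ?_ (expGrowthSup_le_of_isClosed hint hbd hΛ isClosed_closure)
    exact ExpGrowth.expGrowthSup_monotone fun n =>
      measure_mono fun ω (hω : S n ω / n ∈ A) => subset_closure hω

/-! ### Moment generating functions of lacunary sums -/

/-- Under the large gap condition the sum of the first `n` frequencies is negligible with respect
to the next one. -/
lemma tendsto_sum_div_succ {a : ℕ → ℕ} (ha : ∀ k, 1 ≤ k → 0 < a k)
    (hgap : Tendsto (fun k : ℕ => (a (k + 1) : ℝ) / (a k : ℝ)) atTop atTop) :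
    Tendsto (fun n => (∑ k ∈ Finset.Icc 1 n, (a k : ℝ)) / a (n + 1)) atTop (𝓝 0) := by
  set q : ℕ → ℝ := fun n => (a n : ℝ) / a (n + 1) with hq
  set r : ℕ → ℝ := fun n => (∑ k ∈ Finset.Icc 1 n, (a k : ℝ)) / a (n + 1) with hr
  have hq0 : Tendsto q atTop (𝓝 0) := by
    refine hgap.inv_tendsto_atTop.congr fun n => ?_
    simp [hq, inv_div]
  have hapos : ∀ n, (0 : ℝ) < a (n + 1) := fun n => by exact_mod_cast ha (n + 1) (by omega)
  -- `r` is eventually bounded because `q ≤ 1 / 2`, and then the recursion forces `r → 0`.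
  have hrec : ∀ n, r (n + 1) = (r n + 1) * q (n + 1) := by
    intro n
    have h1 := (hapos n).ne'
    have h2 := (hapos (n + 1)).ne'
    simp only [hr, hq]
    rw [Finset.sum_Icc_succ_top (by omega)]
    field_simp
  have hr_nonneg : ∀ n, 0 ≤ r n := fun n => by positivity
  obtain ⟨N, hN⟩ := eventually_atTop.1 (hq0.eventually_le_const (show (0 : ℝ) < 1 / 2 by norm_num))
  have hbd : ∀ n ≥ N, r n ≤ max (r N) 1 := by
    intro n hn
    induction n, hn using Nat.le_induction with
    | base => exact le_max_left _ _
    | succ n hn ih =>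
      have h1 := hN (n + 1) (by omega)
      have h2 : 1 ≤ max (r N) 1 := le_max_right _ _
      calc r (n + 1) = (r n + 1) * q (n + 1) := hrec n
        _ ≤ (r n + 1) * (1 / 2) := by
            have := hr_nonneg n
            gcongr
        _ ≤ max (r N) 1 := by linarith
  rw [← tendsto_add_atTop_iff_nat 1]
  refine squeeze_zero' (Eventually.of_forall fun n => hr_nonneg (n + 1)) ?_
    (show Tendsto (fun n => (max (r N) 1 + 1) * q (n + 1)) atTop (𝓝 0) by
      simpa using ((tendsto_add_atTop_iff_nat 1).2 hq0).const_mul (max (r N) 1 + 1))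
  filter_upwards [eventually_ge_atTop N] with n hn
  rw [hrec]
  have hqn : 0 ≤ q (n + 1) := by positivity
  gcongr
  exact hbd n hn

/-- If `g` varies by at most a factor `K` over distances `1 / m` and `f` is nonnegative of period `1`,
then on `[0, 1]` the integral of `g u * f (m u)` is the product of the integrals of `g` and `f`, up
to the factor `K`. The reason is that `g` may be frozen on each of the `m` periods of `f (m ·)`. -/
lemma integral_mul_comp_mul_le {f g : ℝ → ℝ} (hf : Continuous f) (hg : Continuous g)
    (hper : Function.Periodic f 1) (hf0 : ∀ u, 0 ≤ f u) {m : ℕ} (hm : 0 < m) {K : ℝ}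
    (hK : ∀ u v : ℝ, |u - v| ≤ 1 / (m : ℝ) → g u ≤ K * g v) :
    ∫ u in (0 : ℝ)..1, g u * f (m * u) ≤
        K * ((∫ u in (0 : ℝ)..1, g u) * ∫ u in (0 : ℝ)..1, f u) ∧
      (∫ u in (0 : ℝ)..1, g u) * (∫ u in (0 : ℝ)..1, f u) ≤
        K * ∫ u in (0 : ℝ)..1, g u * f (m * u) := by
  have hm' : (0 : ℝ) < m := by exact_mod_cast hm
  have hI : ∀ h : ℝ → ℝ, Continuous h → ∀ b c, IntervalIntegrable h volume b c :=
    fun h hh b c => hh.intervalIntegrable b c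
  set J := ∫ u in (0 : ℝ)..1, f u with hJ
  have hfm : Continuous fun u : ℝ => f (m * u) := by fun_prop
  have hgf : Continuous fun u : ℝ => g u * f (m * u) := by fun_prop
  have hsplit : ∀ h : ℝ → ℝ, Continuous h → ∫ u in (0 : ℝ)..1, h u =
      ∑ j ∈ Finset.range m, ∫ u in ((j : ℝ) / m)..((j + 1 : ℕ) : ℝ) / m, h u := by
    intro h hh
    rw [intervalIntegral.sum_integral_adjacent_intervals (a := fun j : ℕ => (j : ℝ) / m)
      fun k _ => hI h hh _ _]
    simp [div_self hm'.ne']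
  have hcell : ∀ j : ℕ, ∫ u in ((j : ℝ) / m)..((j + 1 : ℕ) : ℝ) / m, f (m * u) = J / m := by
    intro j
    rw [intervalIntegral.integral_comp_mul_left f hm'.ne', mul_div_cancel₀ _ hm'.ne',
      mul_div_cancel₀ _ hm'.ne', Nat.cast_add, Nat.cast_one, hper.intervalIntegral_add_eq j 0,
      zero_add, smul_eq_mul]
    field_simp
    rfl
  have hle : ∀ j : ℕ, (j : ℝ) / m ≤ ((j + 1 : ℕ) : ℝ) / m := fun j => by
    gcongr
    simp
  have hlen : ∀ j : ℕ, ((j + 1 : ℕ) : ℝ) / m - (j : ℝ) / m = 1 / m := fun j => by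
    push_cast
    ring
  have hclose : ∀ (j : ℕ) (u v : ℝ), u ∈ Set.Icc ((j : ℝ) / m) (((j + 1 : ℕ) : ℝ) / m) →
      v ∈ Set.Icc ((j : ℝ) / m) (((j + 1 : ℕ) : ℝ) / m) → |u - v| ≤ 1 / m := by
    intro j u v hu hv
    have := hlen j
    rw [abs_le]
    constructor <;> linarith [hu.1, hu.2, hv.1, hv.2]
  constructor
  · have hstep : ∀ j : ℕ, ∫ u in ((j : ℝ) / m)..((j + 1 : ℕ) : ℝ) / m, g u * f (m * u) ≤
        K * J * ∫ v in ((j : ℝ) / m)..((j + 1 : ℕ) : ℝ) / m, g v := by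
      intro j
      have h1 : ∀ v ∈ Set.Icc ((j : ℝ) / m) (((j + 1 : ℕ) : ℝ) / m),
          ∫ u in ((j : ℝ) / m)..((j + 1 : ℕ) : ℝ) / m, g u * f (m * u) ≤ K * (J / m) * g v := by
        intro v hv
        calc ∫ u in ((j : ℝ) / m)..((j + 1 : ℕ) : ℝ) / m, g u * f (m * u)
            ≤ ∫ u in ((j : ℝ) / m)..((j + 1 : ℕ) : ℝ) / m, K * g v * f (m * u) :=
              intervalIntegral.integral_mono_on (hle j) (hI _ hgf _ _)
                (hI _ (by fun_prop) _ _) fun u hu =>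
                mul_le_mul_of_nonneg_right (hK u v (hclose j u v hu hv)) (hf0 _)
          _ = K * (J / m) * g v := by
              rw [intervalIntegral.integral_const_mul, hcell]
              ring
      have h2 := intervalIntegral.integral_mono_on (μ := volume) (hle j)
        (hI (fun _ => _) continuous_const _ _) (hI _ (by fun_prop) _ _) h1
      rw [intervalIntegral.integral_const, hlen, intervalIntegral.integral_const_mul,
        smul_eq_mul] at h2
      have h3 := mul_le_mul_of_nonneg_left h2 hm'.le
      calc _ = (m : ℝ) * (1 / m * ∫ u in ((j : ℝ) / m)..((j + 1 : ℕ) : ℝ) / m,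
              g u * f (m * u)) := by field_simp
        _ ≤ _ := h3
        _ = _ := by field_simp
    rw [hsplit _ hgf, hsplit g hg, mul_comm (Finset.sum _ _) J, ← mul_assoc, Finset.mul_sum]
    exact Finset.sum_le_sum fun j _ => hstep j
  · have hstep : ∀ j : ℕ, J * ∫ v in ((j : ℝ) / m)..((j + 1 : ℕ) : ℝ) / m, g v ≤
        K * ∫ u in ((j : ℝ) / m)..((j + 1 : ℕ) : ℝ) / m, g u * f (m * u) := by
      intro j
      have h1 : ∀ v ∈ Set.Icc ((j : ℝ) / m) (((j + 1 : ℕ) : ℝ) / m), g v * (J / m) ≤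
          K * ∫ u in ((j : ℝ) / m)..((j + 1 : ℕ) : ℝ) / m, g u * f (m * u) := by
        intro v hv
        calc g v * (J / m)
            = ∫ u in ((j : ℝ) / m)..((j + 1 : ℕ) : ℝ) / m, g v * f (m * u) := by
              rw [intervalIntegral.integral_const_mul, hcell]
          _ ≤ ∫ u in ((j : ℝ) / m)..((j + 1 : ℕ) : ℝ) / m, K * (g u * f (m * u)) :=
              intervalIntegral.integral_mono_on (hle j) (hI _ (by fun_prop) _ _)
                (hI _ (by fun_prop) _ _) fun u hu => by
                  rw [← mul_assoc]
                  exact mul_le_mul_of_nonneg_right (hK v u (hclose j v u hv hu)) (hf0 _)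
          _ = _ := intervalIntegral.integral_const_mul _ _
      have h2 := intervalIntegral.integral_mono_on (μ := volume) (hle j)
        (hI _ (by fun_prop) _ _) (hI (fun _ => _) continuous_const _ _) h1
      rw [intervalIntegral.integral_const, hlen, intervalIntegral.integral_mul_const,
        smul_eq_mul] at h2
      have h3 := mul_le_mul_of_nonneg_left h2 hm'.le
      calc _ = (m : ℝ) * ((∫ v in ((j : ℝ) / m)..((j + 1 : ℕ) : ℝ) / m, g v) * (J / m)) := by
              field_simp
        _ ≤ _ := h3
        _ = _ := by field_simp
    rw [hsplit _ hgf, hsplit g hg, mul_comm (Finset.sum _ _) J, Finset.mul_sum, Finset.mul_sum]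
    exact Finset.sum_le_sum fun j _ => hstep j

lemma continuous_lacunarySum (a : ℕ → ℕ) (n : ℕ) :
    Continuous fun u : ℝ => lacunarySum a id n u := by
  unfold lacunarySum
  simp only [id]
  fun_prop

lemma continuous_exp_mul_lacunarySum (a : ℕ → ℕ) (θ : ℝ) (n : ℕ) :
    Continuous fun u : ℝ => Real.exp (θ * lacunarySum a id n u) :=
  Real.continuous_exp.comp (continuous_const.mul (continuous_lacunarySum a n))

lemma abs_lacunarySum_le {Ω : Type*} (a : ℕ → ℕ) (U : Ω → ℝ) (n : ℕ) (ω : Ω) :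
    |lacunarySum a U n ω| ≤ n := by
  calc |lacunarySum a U n ω| ≤ ∑ _k ∈ Finset.Icc 1 n, (1 : ℝ) :=
        (Finset.abs_sum_le_sum_abs _ _).trans (Finset.sum_le_sum fun k _ => Real.abs_cos_le_one _)
    _ = n := by simp

lemma lacunarySum_sub_le (a : ℕ → ℕ) (n : ℕ) (u v : ℝ) :
    |lacunarySum a id n u - lacunarySum a id n v| ≤
      2 * Real.pi * (∑ k ∈ Finset.Icc 1 n, (a k : ℝ)) * |u - v| := by
  unfold lacunarySum
  rw [← Finset.sum_sub_distrib, Finset.mul_sum, Finset.sum_mul]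
  refine (Finset.abs_sum_le_sum_abs _ _).trans (Finset.sum_le_sum fun k _ => ?_)
  have h := Real.lipschitzWith_cos.dist_le_mul (2 * Real.pi * a k * u) (2 * Real.pi * a k * v)
  rw [Real.dist_eq, Real.dist_eq, NNReal.coe_one, one_mul, ← mul_sub, abs_mul,
    abs_of_nonneg (show 0 ≤ 2 * Real.pi * (a k : ℝ) by positivity)] at h
  exact h

/-- The moment generating function of the lacunary sum for the uniform variable `U = id`. -/
noncomputable def lacunaryMGF (a : ℕ → ℕ) (θ : ℝ) (n : ℕ) : ℝ :=
  ∫ u in (0 : ℝ)..1, Real.exp (θ * lacunarySum a id n u)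

lemma lacunaryMGF_pos (a : ℕ → ℕ) (θ : ℝ) (n : ℕ) : 0 < lacunaryMGF a θ n :=
  intervalIntegral.intervalIntegral_pos_of_pos
    ((continuous_exp_mul_lacunarySum a θ n).intervalIntegrable _ _)
    (fun _ => Real.exp_pos _) zero_lt_one

/-- Adding one frequency multiplies the moment generating function by that of the arcsine law, up
to a factor which the large gap condition forces to `1`. -/
lemma abs_log_lacunaryMGF_succ_sub_le {a : ℕ → ℕ} (ha : ∀ k, 1 ≤ k → 0 < a k) (θ : ℝ) (n : ℕ) :
    |Real.log (lacunaryMGF a θ (n + 1)) - Real.log (lacunaryMGF a θ n) - arcsineLogMGF θ| ≤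
      |θ| * (2 * Real.pi) * ((∑ k ∈ Finset.Icc 1 n, (a k : ℝ)) / a (n + 1)) := by
  set ε := |θ| * (2 * Real.pi) * ((∑ k ∈ Finset.Icc 1 n, (a k : ℝ)) / a (n + 1)) with hε
  have hm : 0 < a (n + 1) := ha (n + 1) (by omega)
  have hprod : lacunaryMGF a θ (n + 1) = ∫ u in (0 : ℝ)..1, Real.exp (θ * lacunarySum a id n u) *
      Real.exp (θ * Real.cos (2 * Real.pi * (a (n + 1) * u))) := by
    refine intervalIntegral.integral_congr fun u _ => ?_
    simp only [lacunarySum, id]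
    rw [Finset.sum_Icc_succ_top (by omega), mul_add, Real.exp_add, mul_assoc (2 * Real.pi) _ u]
  have hper : Function.Periodic (fun u : ℝ => Real.exp (θ * Real.cos (2 * Real.pi * u))) 1 := by
    intro u
    simp [mul_add, Real.cos_add_two_pi]
  have hK : ∀ u v, |u - v| ≤ 1 / (a (n + 1) : ℝ) → Real.exp (θ * lacunarySum a id n u) ≤
      Real.exp ε * Real.exp (θ * lacunarySum a id n v) := by
    intro u v huv
    rw [← Real.exp_add, Real.exp_le_exp, ← sub_le_iff_le_add, ← mul_sub]
    calc θ * (lacunarySum a id n u - lacunarySum a id n v)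
        ≤ |θ| * |lacunarySum a id n u - lacunarySum a id n v| :=
          (le_abs_self _).trans (abs_mul _ _).le
      _ ≤ |θ| * (2 * Real.pi * (∑ k ∈ Finset.Icc 1 n, (a k : ℝ)) * (1 / a (n + 1))) := by
          gcongr
          refine (lacunarySum_sub_le a n u v).trans ?_
          gcongr
      _ = ε := by rw [hε]; ring
  obtain ⟨h1, h2⟩ := integral_mul_comp_mul_le
    (f := fun u : ℝ => Real.exp (θ * Real.cos (2 * Real.pi * u))) (by fun_prop)
    (continuous_exp_mul_lacunarySum a θ n) hper
    (fun u => (Real.exp_pos _).le) hm hK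
  rw [← hprod, ← exp_arcsineLogMGF] at h1 h2
  change lacunaryMGF a θ (n + 1) ≤
    Real.exp ε * (lacunaryMGF a θ n * Real.exp (arcsineLogMGF θ)) at h1
  change lacunaryMGF a θ n * Real.exp (arcsineLogMGF θ) ≤
    Real.exp ε * lacunaryMGF a θ (n + 1) at h2
  have p0 := lacunaryMGF_pos a θ n
  have p1 := lacunaryMGF_pos a θ (n + 1)
  have l1 := Real.log_le_log p1 h1
  have l2 := Real.log_le_log (by positivity) h2
  rw [Real.log_mul (Real.exp_pos _).ne' (by positivity), Real.log_mul p0.ne' (Real.exp_pos _).ne',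
    Real.log_exp, Real.log_exp] at l1
  rw [Real.log_mul (Real.exp_pos _).ne' p1.ne', Real.log_mul p0.ne' (Real.exp_pos _).ne',
    Real.log_exp, Real.log_exp] at l2
  rw [abs_le]
  constructor <;> linarith

lemma tendsto_log_lacunaryMGF_div {a : ℕ → ℕ} (ha : ∀ k, 1 ≤ k → 0 < a k)
    (hgap : Tendsto (fun k : ℕ => (a (k + 1) : ℝ) / (a k : ℝ)) atTop atTop) (θ : ℝ) :
    Tendsto (fun n : ℕ => Real.log (lacunaryMGF a θ n) / n) atTop (𝓝 (arcsineLogMGF θ)) := by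
  have hinc : Tendsto (fun n => Real.log (lacunaryMGF a θ (n + 1)) - Real.log (lacunaryMGF a θ n))
      atTop (𝓝 (arcsineLogMGF θ)) := by
    rw [tendsto_iff_dist_tendsto_zero]
    refine squeeze_zero (fun _ => dist_nonneg)
      (fun n => abs_log_lacunaryMGF_succ_sub_le ha θ n) ?_
    simpa using (tendsto_sum_div_succ ha hgap).const_mul (|θ| * (2 * Real.pi))
  -- The sum telescopes, and `lacunaryMGF a θ 0 = 1`.
  refine hinc.cesaro.congr fun n => ?_
  rw [Finset.sum_range_sub (fun n => Real.log (lacunaryMGF a θ n))]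
  simp [lacunaryMGF, lacunarySum, div_eq_inv_mul]

lemma cgf_lacunarySum {Ω : Type*} [MeasurableSpace Ω] {P : Measure Ω} {U : Ω → ℝ}
    (hU : pdf.IsUniform U (Set.Icc (0 : ℝ) 1) P volume) (a : ℕ → ℕ) (θ : ℝ) (n : ℕ) :
    cgf (lacunarySum a U n) P θ = Real.log (lacunaryMGF a θ n) := by
  have hUm : AEMeasurable U P := hU.aemeasurable (by simp) (by simp)
  have hmap : Measure.map U P = volume.restrict (Set.Icc (0 : ℝ) 1) := by
    rw [hU, ProbabilityTheory.cond]
    simp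
  rw [cgf, lacunaryMGF, intervalIntegral.integral_of_le zero_le_one, ← integral_Icc_eq_integral_Ioc,
    ← hmap, integral_map hUm (continuous_exp_mul_lacunarySum a θ n).aestronglyMeasurable]
  rfl

/-! ### Independent arcsine variables -/

lemma cgf_sum_of_hasLaw_arcsineLaw {Ω : Type*} [MeasurableSpace Ω] {P : Measure Ω} {X : ℕ → Ω → ℝ}
    (hX : iIndepFun X P) (hlaw : ∀ k, HasLaw (X k) arcsineLaw P) (θ : ℝ) (n : ℕ) :
    cgf (fun ω => ∑ k ∈ Finset.Icc 1 n, X k ω) P θ = n * arcsineLogMGF θ := by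
  have hint : ∀ k, Integrable (fun ω => Real.exp (θ * X k ω)) P := fun k =>
    ((hlaw k).map_eq ▸ integrable_exp_mul_arcsineLaw θ :
      Integrable (fun x : ℝ => Real.exp (θ * x)) (P.map (X k))).comp_aemeasurable
        (hlaw k).aemeasurable
  have hk : ∀ k, cgf (X k) P θ = arcsineLogMGF θ := fun k => by
    rw [arcsineLogMGF, cgf, cgf, mgf, mgf]
    congr 1
    exact (hlaw k).integral_comp (f := fun x => Real.exp (θ * x)) (by fun_prop)
  have h := hX.cgf_sum₀ (fun k => (hlaw k).aemeasurable) (s := Finset.Icc 1 n)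
    (t := θ) fun k _ => hint k
  simp only [hk, Finset.sum_const, Nat.card_Icc, add_tsub_cancel_right, nsmul_eq_mul] at h
  rw [← h]
  congr 1
  ext ω
  simp

end LacunaryLDP

theorem theoremA
    (a : ℕ → ℕ) (ha : ∀ k, 1 ≤ k → 0 < a k)
    (hgap : Tendsto (fun k : ℕ => (a (k + 1) : ℝ) / (a k : ℝ)) atTop atTop) :
    (∀ (Ω : Type*) [MeasurableSpace Ω] (P : Measure Ω) [IsProbabilityMeasure P] (U : Ω → ℝ),
      pdf.IsUniform U (Set.Icc (0 : ℝ) 1) P volume →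
        LacunaryLDP.SatisfiesLDP P
          (fun n ω => LacunaryLDP.lacunarySum a U n ω / (n : ℝ))
          (fun n => (n : ℝ)) LacunaryLDP.arcsineRate) ∧
    (∀ (Ω : Type*) [MeasurableSpace Ω] (P : Measure Ω) [IsProbabilityMeasure P] (X : ℕ → Ω → ℝ),
      iIndepFun X P → (∀ k, HasLaw (X k) LacunaryLDP.arcsineLaw P) →
        LacunaryLDP.SatisfiesLDP P
          (fun n ω => (∑ k ∈ Finset.Icc 1 n, X k ω) / (n : ℝ))
          (fun n => (n : ℝ)) LacunaryLDP.arcsineRate) := by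
  refine ⟨fun Ω _ P _ U hU => ?_, fun Ω _ P _ X hX hlaw => ?_⟩
  · have hUm : AEMeasurable U P := hU.aemeasurable (by simp) (by simp)
    refine LacunaryLDP.satisfiesLDP_arcsineRate
      (fun n => (LacunaryLDP.continuous_lacunarySum a n).measurable.comp_aemeasurable hUm)
      (fun n => ae_of_all _ (LacunaryLDP.abs_lacunarySum_le a U n)) fun θ => ?_
    simp only [LacunaryLDP.cgf_lacunarySum hU]
    exact LacunaryLDP.tendsto_log_lacunaryMGF_div ha hgap θ
  · refine LacunaryLDP.satisfiesLDP_arcsineRate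
      (fun n => Finset.aemeasurable_fun_sum _ fun k _ => (hlaw k).aemeasurable)
      (fun n => ?_) fun θ => ?_
    · have hk : ∀ k, ∀ᵐ ω ∂P, X k ω ∈ Set.Icc (-1 : ℝ) 1 := fun k =>
        ae_of_ae_map (hlaw k).aemeasurable
          ((hlaw k).map_eq ▸ LacunaryLDP.ae_arcsineLaw_mem_Icc)
      filter_upwards [ae_all_iff.2 hk] with ω hω
      calc |∑ k ∈ Finset.Icc 1 n, X k ω| ≤ ∑ _k ∈ Finset.Icc 1 n, (1 : ℝ) :=
            (Finset.abs_sum_le_sum_abs _ _).trans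
              (Finset.sum_le_sum fun k _ => abs_le.2 (hω k))
        _ = n := by simp
    · simp only [LacunaryLDP.cgf_sum_of_hasLaw_arcsineLaw hX hlaw]
      refine tendsto_const_nhds.congr' ?_
      filter_upwards [eventually_gt_atTop 0] with n hn
      have : (n : ℝ) ≠ 0 := by positivity
      field_simp
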